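/- Let $(H,(\cdot,\cdot))$ be a complex Hilbert space. A \emph{Kreĭn space} $(K,[\cdot,\cdot])$ is a complex vector space with a Hermitian sesquilinear form that admits a direct, $[\cdot,\cdot]$-orthogonal decomposition $K=K^+\oplus K^-$ such that $(K^+,[\cdot,\cdot])$ and $(K^-,-[\cdot,\cdot])$ are Hilbert spaces. With the projections $P^\pm$ onto $K^\pm$ put $J=P^+-P^-$ and $\{f,g\}=[Jf,g]$; the topology of $K$ is that of the Hilbert space $(K,\{\cdot,\cdot\})$. A densely defined operator $A$ in $K$ is J-self-adjoint (J-non-negative) if $JA$ is self-adjoint (non-negative) in $(K,\{\cdot,\cdot\})$; it is boundedly invertible if it maps $\operatorname{dom}A$ bijectively onto $K$ with bounded inverse. None of this depends on the chosen decomposition. A Kreĭn space $(K,[\cdot,\cdot])$ is a \emph{Kreĭn space completion} of an inner product space $(\widetilde K,[\cdot,\cdot]^\sim)$ if $\widetilde K$ is a dense subspace of $K$ and the two inner products coincide on $\widetilde K$. A densely defined symmetric sesquilinear form $\mathfrak t[\cdot,\cdot]$ in $H$ is \emph{closed} if for some $\lambda\in\mathbb R$, called a \emph{gap point}, $(\operatorname{dom}\mathfrak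 t,\mathfrak t_\lambda[\cdot,\cdot])$ with $\mathfrak t_\lambda[\cdot,\cdot]=\mathfrak t[\cdot,\cdot]-\lambda(\cdot,\cdot)$ is a Kreĭn space continuously embedded in $H$. A \emph{closure} of a form $\mathfrak s$ is a closed form $\mathfrak t$ extending $\mathfrak s$ such that $\operatorname{dom}\mathfrak s$ is dense in $(\operatorname{dom}\mathfrak t,\mathfrak t_\lambda[\cdot,\cdot])$ for some gap point $\lambda$ of $\mathfrak t$. The \emph{representing operator} $T_{\mathfrak t}$ of a closed form $\mathfrak t$ is the unique self-adjoint operator in $H$ with $\operatorname{dom}T_{\mathfrak t}\subset\operatorname{dom}\mathfrak t$ and $\mathfrak t[u,v]=(T_{\mathfrak t}u,v)$ for $u\in\operatorname{dom}T_{\mathfrak t}$, $v\in\operatorname{dom}\mathfrak t$. The \emph{range restriction} $A_{\mathfrak t}$ is the restriction of $T_{\mathfrak t}$ to $\operatorname{dom}A_{\mathfrak t}=T_{\mathfrak t}^{-1}(\operatorname{dom}\mathfrak t)$, regarded as an operator in $\operatorname{dom}\mathfrak t$. \textbf{Theorem.} Let $T$ be a self-adjoint and boundedly invertible operator in $H$.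 Let $\mathcal M_T$ be the set of all closures of the form $(T\cdot,\cdot)$, with domain $\operatorname{dom}T$, in $H$. Let $\mathcal N_T$ be the set of all triples $(K,[\cdot,\cdot],A)$ such that $(K,[\cdot,\cdot])$, with $K\subset H$, is a Kreĭn space completion of $(\operatorname{dom}T,(T\cdot,\cdot))$ that is continuously embedded in $H$, and $A=T|_{\operatorname{dom}A}$ with $\operatorname{dom}A=T^{-1}(K)$. Then: \begin{enumerate} \item The rule $\mathfrak t\mapsto(\operatorname{dom}\mathfrak t,\mathfrak t[\cdot,\cdot],A_{\mathfrak t})$ is a bijection from $\mathcal M_T$ onto $\mathcal N_T$. \item For every $(K,[\cdot,\cdot],A)\in\mathcal N_T$ the operator $A$ is J-non-negative, J-self-adjoint and boundedly invertible in the Kreĭn space $(K,[\cdot,\cdot])$. \item $\mathcal M_T$ is the set of all closed forms $\mathfrak t$ in $H$ with gap point $0$ and $T_{\mathfrak t}=T$; it is also the set of all closed forms $\mathfrak t$ in $H$ with $T_{\mathfrak t}=T$. \end{enumerate} -/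

import Mathlib

noncomputable section

/-! ### Kreĭn spaces

An inner product `[·,·]` on a complex vector space `K` is a sesquilinear form
`B : K →ₗ⋆[ℂ] K →ₗ[ℂ] ℂ`, conjugate-linear in the first variable (Mathlib's convention for
`inner`). -/

section KreinSpaces

variable {K : Type*} [AddCommGroup K] [Module ℂ K]

/-- `(L, [·,·])` is a Hilbert space: `[·,·]` is positive definite on `L`, and every sequence in `L`
which is Cauchy for the norm `[x, x] ^ (1 / 2)` converges in this norm to an element of `L`. -/
structure IsHilbertOn (B : K →ₗ⋆[ℂ] K →ₗ[ℂ] ℂ) (L : Submodule ℂ K) : Prop where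
  pos : ∀ x ∈ L, x ≠ 0 → 0 < (B x x).re
  complete : ∀ u : ℕ → K, (∀ n, u n ∈ L) →
    (∀ ε : ℝ, 0 < ε → ∃ N, ∀ m ≥ N, ∀ n ≥ N, √(B (u m - u n) (u m - u n)).re < ε) →
    ∃ x ∈ L, ∀ ε : ℝ, 0 < ε → ∃ N, ∀ n ≥ N, √(B (u n - x) (u n - x)).re < ε

/-- `K = P ⊕ M` is a fundamental decomposition of `(K, [·,·])`: the sum is direct and
`[·,·]`-orthogonal, `(P, [·,·])` is a Hilbert space, and `(M, [·,·])` is an anti-Hilbert space. -/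
structure IsFundamentalDecomposition (B : K →ₗ⋆[ℂ] K →ₗ[ℂ] ℂ) (P M : Submodule ℂ K) : Prop where
  isCompl : IsCompl P M
  orthogonal : ∀ x ∈ P, ∀ y ∈ M, B x y = 0
  hilbert : IsHilbertOn B P
  antiHilbert : IsHilbertOn (-B) M

/-- `(K, [·,·])` is a Kreĭn space. -/
def IsKreinSpace (B : K →ₗ⋆[ℂ] K →ₗ[ℂ] ℂ) : Prop :=
  B.IsSymm ∧ ∃ P M : Submodule ℂ K, IsFundamentalDecomposition B P M

/-- `J` is a fundamental symmetry: `J = P⁺ - P⁻` for the projections belonging to some fundamental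
decomposition. -/
def IsFundamentalSymmetry (B : K →ₗ⋆[ℂ] K →ₗ[ℂ] ℂ) (J : K →ₗ[ℂ] K) : Prop :=
  ∃ P M : Submodule ℂ K, IsFundamentalDecomposition B P M ∧
    (∀ x ∈ P, J x = x) ∧ (∀ x ∈ M, J x = -x)

/-- The Hilbert space inner product `{x, y} = [J x, y]`. -/
def jInner (B : K →ₗ⋆[ℂ] K →ₗ[ℂ] ℂ) (J : K →ₗ[ℂ] K) (x y : K) : ℂ := B (J x) y

/-- The Hilbert space norm `{x, x} ^ (1 / 2)`; it induces the topology of the Kreĭn space. -/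
def jNorm (B : K →ₗ⋆[ℂ] K →ₗ[ℂ] ℂ) (J : K →ₗ[ℂ] K) (x : K) : ℝ := √(jInner B J x x).re

/-- `D` is dense in the topology of the Kreĭn space `(K, [·,·])`. (The topology does not depend on
the fundamental symmetry; it is tested here with each of them.) -/
def KreinDense (B : K →ₗ⋆[ℂ] K →ₗ[ℂ] ℂ) (D : Set K) : Prop :=
  ∀ J, IsFundamentalSymmetry B J → ∀ x : K, ∀ ε : ℝ, 0 < ε → ∃ d ∈ D, jNorm B J (x - d) < ε

/-- `A` is J-self-adjoint in the Kreĭn space `(K, [·,·])`: it is densely defined, and `J A` is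
self-adjoint in the Hilbert space `(K, {·,·})`, i.e. `(g, k)` belongs to the graph of `J A` if and
only if `{J A f, g} = {f, k}` for all `f ∈ dom A`. -/
def IsJSelfAdjoint (B : K →ₗ⋆[ℂ] K →ₗ[ℂ] ℂ) (A : K →ₗ.[ℂ] K) : Prop :=
  KreinDense B (A.domain : Set K) ∧
  ∀ J, IsFundamentalSymmetry B J → ∀ g k : K,
    (∃ h : g ∈ A.domain, J (A ⟨g, h⟩) = k) ↔
      ∀ f : A.domain, jInner B J (J (A f)) g = jInner B J (f : K) k

/-- `A` is J-non-negative in the Kreĭn space `(K, [·,·])`: it is densely defined, and `J A` is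
non-negative in the Hilbert space `(K, {·,·})`. -/
def IsJNonneg (B : K →ₗ⋆[ℂ] K →ₗ[ℂ] ℂ) (A : K →ₗ.[ℂ] K) : Prop :=
  KreinDense B (A.domain : Set K) ∧
  ∀ J, IsFundamentalSymmetry B J → ∀ f : A.domain,
    0 ≤ (jInner B J (J (A f)) (f : K)).re ∧ (jInner B J (J (A f)) (f : K)).im = 0

/-- `A` is boundedly invertible in the Kreĭn space `(K, [·,·])`: it maps `dom A` bijectively onto
`K`, and the inverse is bounded. -/
def IsJBoundedlyInvertible (B : K →ₗ⋆[ℂ] K →ₗ[ℂ] ℂ) (A : K →ₗ.[ℂ] K) : Prop :=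
  Function.Bijective A ∧
  ∀ J, IsFundamentalSymmetry B J → ∃ C : ℝ, ∀ f : A.domain, jNorm B J (f : K) ≤ C * jNorm B J (A f)

/-- The triple `(K, [·,·], A)` belongs to the class `𝒩`: `(K, [·,·])` is a Kreĭn space and `A` is
J-non-negative, J-self-adjoint and boundedly invertible in it. -/
def MemClassN (B : K →ₗ⋆[ℂ] K →ₗ[ℂ] ℂ) (A : K →ₗ.[ℂ] K) : Prop :=
  IsKreinSpace B ∧ IsJNonneg B A ∧ IsJSelfAdjoint B A ∧ IsJBoundedlyInvertible B A

end KreinSpaces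

section Forms

variable {H : Type*} [NormedAddCommGroup H] [InnerProductSpace ℂ H]

/-- The Kreĭn space `(K, [·,·])`, where `K` is a subspace of the Hilbert space `H`, is continuously
embedded in `H`. -/
def ContinuouslyEmbedded {K : Submodule ℂ H} (B : K →ₗ⋆[ℂ] K →ₗ[ℂ] ℂ) : Prop :=
  ∀ J, IsFundamentalSymmetry B J → ∃ C : ℝ, ∀ x : K, ‖(x : H)‖ ≤ C * jNorm B J x

variable (H) in
/-- A densely defined symmetric sesquilinear form in `H`. -/
@[ext]
structure SymmForm where
  domain : Submodule ℂ H
  form : domain →ₗ⋆[ℂ] domain →ₗ[ℂ] ℂ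
  dense_domain : Dense (domain : Set H)
  symm : form.IsSymm

namespace SymmForm

/-- The inner product `𝔱_lam[·,·] = 𝔱[·,·] - lam (·,·)` on `dom 𝔱`. -/
def shift (t : SymmForm H) (lam : ℝ) : t.domain →ₗ⋆[ℂ] t.domain →ₗ[ℂ] ℂ :=
  t.form - (lam : ℂ) • (innerₛₗ ℂ : H →ₗ⋆[ℂ] H →ₗ[ℂ] ℂ).domRestrict₁₂ t.domain t.domain

/-- `lam` is a gap point of `𝔱`: `(dom 𝔱, 𝔱_lam)` is a Kreĭn space, continuously embedded in `H`. -/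
def IsGapPoint (t : SymmForm H) (lam : ℝ) : Prop :=
  IsKreinSpace (t.shift lam) ∧ ContinuouslyEmbedded (t.shift lam)

/-- A form is closed if it has a gap point. -/
def IsClosedForm (t : SymmForm H) : Prop := ∃ lam : ℝ, t.IsGapPoint lam

/-- `t` is an extension of `s`. -/
def Extends (t s : SymmForm H) : Prop :=
  ∃ h : s.domain ≤ t.domain, ∀ u v : s.domain, t.form ⟨u, h u.2⟩ ⟨v, h v.2⟩ = s.form u v

/-- `t` is a closure of `s`: a closed extension such that `dom s` is dense in the Kreĭn space
`(dom t, t_lam)` for some gap point `lam` of `t`. -/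
def IsClosureOf (t s : SymmForm H) : Prop :=
  t.IsClosedForm ∧ t.Extends s ∧
    ∃ lam : ℝ, t.IsGapPoint lam ∧ KreinDense (t.shift lam) {x | (x : H) ∈ s.domain}

variable [CompleteSpace H]

/-- `S` is the representing operator `T_𝔱` of `𝔱`: the (unique, see
`IsRepresentingOperator.unique`) self-adjoint operator with `dom S ⊆ dom 𝔱` and
`𝔱[u, v] = (S u, v)` for `u ∈ dom S`, `v ∈ dom 𝔱`. -/
def IsRepresentingOperator (t : SymmForm H) (S : H →ₗ.[ℂ] H) : Prop :=
  IsSelfAdjoint S ∧ ∃ h : S.domain ≤ t.domain,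
    ∀ (u : S.domain) (v : t.domain), t.form ⟨u, h u.2⟩ v = inner ℂ (S u) (v : H)

theorem IsRepresentingOperator.unique {t : SymmForm H} {S S' : H →ₗ.[ℂ] H}
    (hS : t.IsRepresentingOperator S) (hS' : t.IsRepresentingOperator S') : S = S' := by
  have key : ∀ {R R' : H →ₗ.[ℂ] H}, t.IsRepresentingOperator R → t.IsRepresentingOperator R' →
      R ≤ R' := by
    rintro R R' ⟨-, h, hr⟩ ⟨hsa', h', hr'⟩
    have hf : R'.IsFormalAdjoint R := by
      intro x y
      have h1 := hr' x ⟨y, h y.2⟩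
      have h2 := hr y ⟨x, h' x.2⟩
      have h3 := t.symm.eq ⟨y, h y.2⟩ ⟨x, h' x.2⟩
      rw [h1, h2] at h3
      rw [← h3]
      exact inner_conj_symm _ _
    have := LinearPMap.IsFormalAdjoint.le_adjoint hsa'.dense_domain hf
    rwa [LinearPMap.isSelfAdjoint_def.mp hsa'] at this
  exact le_antisymm (key hS hS') (key hS' hS)

open Classical in
/-- The representing operator `T_𝔱` of `𝔱` (with a junk value if there is none). -/
def representingOperator (t : SymmForm H) : H →ₗ.[ℂ] H :=
  if h : ∃ S, t.IsRepresentingOperator S then h.choose else ⊥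

theorem IsRepresentingOperator.eq {t : SymmForm H} {S : H →ₗ.[ℂ] H}
    (hS : t.IsRepresentingOperator S) : t.representingOperator = S := by
  have h : ∃ S, t.IsRepresentingOperator S := ⟨S, hS⟩
  rw [representingOperator, dif_pos h]
  exact h.choose_spec.unique hS

end SymmForm

/-- An operator `T` in `H` is boundedly invertible: it maps `dom T` bijectively onto `H`, and the
inverse is bounded. -/
def IsBoundedlyInvertible (T : H →ₗ.[ℂ] H) : Prop :=
  Function.Bijective T ∧ ∃ C : ℝ, ∀ f : T.domain, ‖(f : H)‖ ≤ C * ‖T f‖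

/-- The form `(T ·, ·)` with domain `dom T`, for a self-adjoint operator `T`. -/
def operatorForm [CompleteSpace H] (T : H →ₗ.[ℂ] H) (hT : IsSelfAdjoint T) : SymmForm H where
  domain := T.domain
  form := ((innerₛₗ ℂ : H →ₗ⋆[ℂ] H →ₗ[ℂ] ℂ).comp T.toFun).domRestrict₂ T.domain
  dense_domain := hT.dense_domain
  symm := ⟨fun x y => by
    have h := LinearPMap.adjoint_isFormalAdjoint hT.dense_domain
    rw [LinearPMap.isSelfAdjoint_def.mp hT] at h
    change (starRingEnd ℂ) (inner ℂ (T x) (y : H)) = inner ℂ (T y) (x : H)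
    rw [inner_conj_symm, h y x]⟩

/-- The restriction of an operator `S` in `H` to the range `K`, as an operator in `K`:
`dom A = {f ∈ K | f ∈ dom S, S f ∈ K}` and `A f = S f`. (If `dom S ⊆ K`, then
`dom A = S⁻¹(K)`.) -/
def rangeRestriction (S : H →ₗ.[ℂ] H) (K : Submodule ℂ H) : K →ₗ.[ℂ] K where
  domain :=
    { carrier := {f | ∃ h : (f : H) ∈ S.domain, S ⟨f, h⟩ ∈ K}
      zero_mem' := ⟨S.domain.zero_mem, by
        have : S ⟨((0 : K) : H), S.domain.zero_mem⟩ = 0 := S.map_zero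
        rw [this]; exact K.zero_mem⟩
      add_mem' := by
        rintro a b ⟨ha, ha'⟩ ⟨hb, hb'⟩
        refine ⟨S.domain.add_mem ha hb, ?_⟩
        have : S ⟨((a + b : K) : H), S.domain.add_mem ha hb⟩ = S ⟨a, ha⟩ + S ⟨b, hb⟩ :=
          S.map_add ⟨a, ha⟩ ⟨b, hb⟩
        rw [this]; exact K.add_mem ha' hb'
      smul_mem' := by
        rintro c a ⟨ha, ha'⟩
        refine ⟨S.domain.smul_mem c ha, ?_⟩
        have : S ⟨((c • a : K) : H), S.domain.smul_mem c ha⟩ = c • S ⟨a, ha⟩ :=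
          S.map_smul c ⟨a, ha⟩
        rw [this]; exact K.smul_mem c ha' }
  toFun :=
    { toFun := fun f => ⟨S ⟨((f : K) : H), f.2.1⟩, f.2.2⟩
      map_add' := fun a b => Subtype.ext (S.map_add ⟨((a : K) : H), a.2.1⟩ ⟨((b : K) : H), b.2.1⟩)
      map_smul' := fun c a => Subtype.ext (S.map_smul c ⟨((a : K) : H), a.2.1⟩) }

variable (H) in
/-- A triple `(K, [·,·], A)`: a subspace `K` of `H` with an inner product `[·,·]` on `K` and an
operator `A` in `K`. -/
structure SpaceTriple where
  space : Submodule ℂ H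
  form : space →ₗ⋆[ℂ] space →ₗ[ℂ] ℂ
  op : space →ₗ.[ℂ] space

/-- `(K, [·,·])` is a Kreĭn space completion of the inner product space `(dom s, s[·,·])`. -/
def IsKreinSpaceCompletion {K : Submodule ℂ H} (B : K →ₗ⋆[ℂ] K →ₗ[ℂ] ℂ) (s : SymmForm H) : Prop :=
  IsKreinSpace B ∧
  (∃ h : s.domain ≤ K, ∀ u v : s.domain, B ⟨u, h u.2⟩ ⟨v, h v.2⟩ = s.form u v) ∧
  KreinDense B {x | (x : H) ∈ s.domain}

variable [CompleteSpace H]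

/-- The rule `Φ`: `K = dom 𝔱`, `[·,·] = 𝔱[·,·]`, and `A = A_𝔱` is the restriction of the representing
operator `T_𝔱` to the range `dom 𝔱`. -/
def formToTriple (t : SymmForm H) : SpaceTriple H where
  space := t.domain
  form := t.form
  op := rangeRestriction t.representingOperator t.domain

/-- The set `ℳ_T` of all closures of `(T ·, ·)` in `H`. -/
def closuresOf (T : H →ₗ.[ℂ] H) (hT : IsSelfAdjoint T) : Set (SymmForm H) :=
  {t | t.IsClosureOf (operatorForm T hT)}

/-- The set `𝒩_T` of all `(K, [·,·], A)` where `(K, [·,·])` is a Kreĭn space completion of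
`(dom T, (T ·, ·))`, continuously embedded in `H`, and `A = T` on `dom A = T⁻¹(K)`. -/
def completionTriplesOf (T : H →ₗ.[ℂ] H) (hT : IsSelfAdjoint T) : Set (SpaceTriple H) :=
  {q | IsKreinSpaceCompletion q.form (operatorForm T hT) ∧ ContinuouslyEmbedded q.form ∧
    q.op = rangeRestriction T q.space}

end Forms

end

/-! The crux is that a form `t` is a closure of `(T·,·)` exactly when `0` is a gap point of `t` and
`T` represents `t`. Given this, a closure and its triple carry the same data: space and inner
product are those of the form, and the operator is determined by `T` and the space.

Every Kreĭn space is handled as a Hilbert space `E` through a fundamental symmetry `J`, so that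
bounded operator theory applies. If `t` is a closure, then `t[u,v] = (Tu,v)` extends from `v ∈ dom
T` to all of `dom t` by density (`IsClosureOf.represents`). The gap point then moves from `λ` to
`0`, because the Gram operator of `t` in `E` is bounded, self-adjoint and, as `T` is bijective,
bijective (`IsClosedForm.isGapPoint_zero`); a form with invertible Gram operator is a Kreĭn inner
product (`isKreinSpace_of_isUnit`).

Conversely, `[T⁻¹y,v] = (y,v)` gives everything else: taking `y = v` shows that `dom T` is dense,
and since `{JT⁻¹x,y} = (x,y)` is Hermitian, `JT⁻¹` is symmetric and everywhere defined on `K`, hence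
bounded. This yields the continuous embedding and the properties of `A` (`Represents.memClassN`). -/

open scoped InnerProductSpace

/-! ### Kreĭn spaces as Hilbert spaces -/

section KreinSpaces

variable {K : Type*} [AddCommGroup K] [Module ℂ K] {B : K →ₗ⋆[ℂ] K →ₗ[ℂ] ℂ} {J : K →ₗ[ℂ] K}

namespace IsFundamentalDecomposition

variable {P M : Submodule ℂ K}

theorem orthogonal' (h : IsFundamentalDecomposition B P M) (hB : B.IsSymm) {x y : K}
    (hx : x ∈ P) (hy : y ∈ M) : B y x = 0 := by
  rw [← hB.eq x y, h.orthogonal x hx y hy, map_zero]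

theorem exists_add (h : IsFundamentalDecomposition B P M) (x : K) :
    ∃ p ∈ P, ∃ m ∈ M, x = p + m := by
  have : x ∈ P ⊔ M := by rw [h.isCompl.sup_eq_top]; trivial
  obtain ⟨p, hp, m, hm, rfl⟩ := Submodule.mem_sup.1 this
  exact ⟨p, hp, m, hm, rfl⟩

theorem exists_fundamentalSymmetry (h : IsFundamentalDecomposition B P M) :
    ∃ J, IsFundamentalSymmetry B J := by
  refine ⟨P.subtype ∘ₗ P.projectionOnto M h.isCompl - M.subtype ∘ₗ M.projectionOnto P h.isCompl.symm,
    P, M, h, fun x hx => ?_, fun x hx => ?_⟩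
  · have h1 := Submodule.projectionOnto_apply_left h.isCompl ⟨x, hx⟩
    have h2 := Submodule.projectionOnto_apply_right h.isCompl.symm ⟨x, hx⟩
    simp_all
  · have h1 := Submodule.projectionOnto_apply_left h.isCompl.symm ⟨x, hx⟩
    have h2 := Submodule.projectionOnto_apply_right h.isCompl ⟨x, hx⟩
    simp_all

end IsFundamentalDecomposition

theorem IsKreinSpace.exists_fundamentalSymmetry (h : IsKreinSpace B) :
    ∃ J, IsFundamentalSymmetry B J := by
  obtain ⟨-, P, M, hPM⟩ := h
  exact hPM.exists_fundamentalSymmetry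

namespace IsFundamentalSymmetry

theorem apply_apply (hJ : IsFundamentalSymmetry B J) (x : K) : J (J x) = x := by
  obtain ⟨P, M, h, hP, hM⟩ := hJ
  obtain ⟨p, hp, m, hm, rfl⟩ := h.exists_add x
  simp [hP p hp, hM m hm]

theorem symmetric (hJ : IsFundamentalSymmetry B J) (hB : B.IsSymm) (x y : K) :
    B (J x) y = B x (J y) := by
  obtain ⟨P, M, h, hP, hM⟩ := hJ
  obtain ⟨p, hp, m, hm, rfl⟩ := h.exists_add x
  obtain ⟨q, hq, n, hn, rfl⟩ := h.exists_add y
  simp [hP p hp, hM m hm, hP q hq, hM n hn, h.orthogonal p hp n hn, h.orthogonal' hB hq hm]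

/-- A fundamental symmetry turns a Kreĭn space into a Hilbert space. -/
theorem exists_hilbertSpace.{u} {K : Type u} [AddCommGroup K] [Module ℂ K]
    {B : K →ₗ⋆[ℂ] K →ₗ[ℂ] ℂ} {J : K →ₗ[ℂ] K}
    (hJ : IsFundamentalSymmetry B J) (hB : B.IsSymm) :
    ∃ (E : Type u) (_ : NormedAddCommGroup E) (_ : InnerProductSpace ℂ E) (_ : CompleteSpace E)
      (e : K ≃ₗ[ℂ] E), ∀ x y, ⟪e x, e y⟫_ℂ = B (J x) y := by
  have hsym := hJ.symmetric hB
  obtain ⟨P, M, h, hP, hM⟩ := hJ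
  have hsplit : ∀ p ∈ P, ∀ m ∈ M, B (J (p + m)) (p + m) = B p p + (-B) m m := by
    intro p hp m hm
    simp [hP p hp, hM m hm, h.orthogonal p hp m hm, h.orthogonal' hB hp hm]
  have posP : ∀ p ∈ P, 0 ≤ (B p p).re := fun p hp => by
    rcases eq_or_ne p 0 with rfl | h0
    · simp
    · exact (h.hilbert.pos p hp h0).le
  have posM : ∀ m ∈ M, 0 ≤ ((-B) m m).re := fun p hp => by
    rcases eq_or_ne p 0 with rfl | h0
    · simp
    · exact (h.antiHilbert.pos p hp h0).le
  let core : InnerProductSpace.Core ℂ K :=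
    { inner := fun x y => B (J x) y
      conj_inner_symm := fun x y => by rw [hB.eq, hsym]
      re_inner_nonneg := fun x => by
        obtain ⟨p, hp, m, hm, rfl⟩ := h.exists_add x
        rw [hsplit p hp m hm]
        exact add_nonneg (posP p hp) (posM m hm)
      add_left := fun x y z => by simp
      smul_left := fun x y r => by simp
      definite := fun x hx => by
        obtain ⟨p, hp, m, hm, rfl⟩ := h.exists_add x
        have hx' : B (J (p + m)) (p + m) = 0 := hx
        rw [hsplit p hp m hm] at hx'
        have h1 := congrArg Complex.re hx'
        rw [Complex.add_re, Complex.zero_re] at h1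
        have hp0 : p = 0 := by
          by_contra h0
          linarith [h.hilbert.pos p hp h0, posM m hm]
        have hm0 : m = 0 := by
          by_contra h0
          linarith [h.antiHilbert.pos m hm h0, posP p hp]
        rw [hp0, hm0, add_zero] }
  let : NormedAddCommGroup K := core.toNormedAddCommGroup
  let : InnerProductSpace ℂ K := InnerProductSpace.ofCore core.toCore
  have hinner : ∀ x y : K, ⟪x, y⟫_ℂ = B (J x) y := fun _ _ => rfl
  have hnorm : ∀ p ∈ P, ∀ m ∈ M, ‖p + m‖ = √((B p p).re + ((-B) m m).re) := by
    intro p hp m hm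
    rw [norm_eq_sqrt_re_inner (𝕜 := ℂ), hinner, hsplit p hp m hm]
    rfl
  refine ⟨K, inferInstance, inferInstance, ?_, LinearEquiv.refl ℂ K, fun x y => rfl⟩
  refine Metric.complete_of_cauchySeq_tendsto fun u hu => ?_
  choose p hp m hm hpm using fun n => h.exists_add (u n)
  have hsub : ∀ i j, u i - u j = (p i - p j) + (m i - m j) := fun i j => by
    rw [hpm i, hpm j]; abel
  rw [Metric.cauchySeq_iff] at hu
  -- The norm of `p + m` dominates the norm of each component, so both component sequences are
  -- Cauchy.
  obtain ⟨x, hxP, hx⟩ := h.hilbert.complete p hp fun ε hε => by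
    obtain ⟨N, hN⟩ := hu ε hε
    refine ⟨N, fun i hi j hj => lt_of_le_of_lt ?_ (hN i hi j hj)⟩
    rw [dist_eq_norm, hsub, hnorm _ (P.sub_mem (hp i) (hp j)) _ (M.sub_mem (hm i) (hm j))]
    exact Real.sqrt_le_sqrt (le_add_of_nonneg_right (posM _ (M.sub_mem (hm i) (hm j))))
  obtain ⟨y, hyM, hy⟩ := h.antiHilbert.complete m hm fun ε hε => by
    obtain ⟨N, hN⟩ := hu ε hε
    refine ⟨N, fun i hi j hj => lt_of_le_of_lt ?_ (hN i hi j hj)⟩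
    rw [dist_eq_norm, hsub, hnorm _ (P.sub_mem (hp i) (hp j)) _ (M.sub_mem (hm i) (hm j))]
    exact Real.sqrt_le_sqrt (le_add_of_nonneg_left (posP _ (P.sub_mem (hp i) (hp j))))
  refine ⟨x + y, Metric.tendsto_atTop.2 fun ε hε => ?_⟩
  obtain ⟨N₁, h₁⟩ := hx (ε / 2) (half_pos hε)
  obtain ⟨N₂, h₂⟩ := hy (ε / 2) (half_pos hε)
  refine ⟨max N₁ N₂, fun n hn => ?_⟩
  have e1 : u n - (x + y) = (p n - x) + (m n - y) := by rw [hpm n]; abel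
  rw [dist_eq_norm, e1, hnorm _ (P.sub_mem (hp n) hxP) _ (M.sub_mem (hm n) hyM)]
  have := h₁ n (le_of_max_le_left hn)
  have := h₂ n (le_of_max_le_right hn)
  have hn₁ := hnorm _ (P.sub_mem (hp n) hxP) 0 M.zero_mem
  have hn₂ := hnorm 0 P.zero_mem _ (M.sub_mem (hm n) hyM)
  rw [map_zero, Complex.zero_re, add_zero, add_zero] at hn₁
  rw [map_zero, Complex.zero_re, zero_add, zero_add] at hn₂
  have := norm_add_le (p n - x) (m n - y)
  rw [hn₁, hn₂, hnorm _ (P.sub_mem (hp n) hxP) _ (M.sub_mem (hm n) hyM)] at this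
  linarith

theorem jNorm_eq {E : Type*} [NormedAddCommGroup E] [InnerProductSpace ℂ E] {e : K ≃ₗ[ℂ] E}
    (he : ∀ x y, ⟪e x, e y⟫_ℂ = B (J x) y) (x : K) : jNorm B J x = ‖e x‖ := by
  rw [norm_eq_sqrt_re_inner (𝕜 := ℂ), he]
  rfl

end IsFundamentalSymmetry

theorem IsKreinSpace.eq_zero_of_forall_left (h : IsKreinSpace B) {x : K} (hx : ∀ y, B y x = 0) :
    x = 0 := by
  obtain ⟨J, hJ⟩ := h.exists_fundamentalSymmetry
  obtain ⟨E, _, _, _, e, he⟩ := hJ.exists_hilbertSpace h.1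
  have : ⟪e x, e x⟫_ℂ = 0 := by rw [he, hx]
  simpa using this

/-- If `z` is `{·,·}`-orthogonal to `D`, then `J z` is `[·,·]`-orthogonal to `D`; hence density can
be tested with the indefinite inner product. -/
theorem IsKreinSpace.kreinDense (h : IsKreinSpace B) (D : Submodule ℂ K)
    (hD : ∀ x, (∀ d ∈ D, B d x = 0) → x = 0) : KreinDense B (D : Set K) := by
  intro J hJ x ε hε
  obtain ⟨E, _, _, _, e, he⟩ := hJ.exists_hilbertSpace h.1
  have htop : (D.map (e : K →ₗ[ℂ] E)).topologicalClosure = ⊤ := by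
    rw [Submodule.topologicalClosure_eq_top_iff, Submodule.eq_bot_iff]
    intro y hy
    obtain ⟨z, rfl⟩ := e.surjective y
    have hz : J z = 0 := hD _ fun d hd => by
      rw [← hJ.symmetric h.1, ← he]
      exact (Submodule.mem_orthogonal _ _).1 hy _ (Submodule.mem_map_of_mem hd)
    rw [← hJ.apply_apply z, hz, map_zero, map_zero]
  have hmem : e x ∈ closure ((D.map (e : K →ₗ[ℂ] E) : Submodule ℂ E) : Set E) := by
    rw [← Submodule.topologicalClosure_coe, htop]; trivial
  obtain ⟨_, ⟨d, hd, rfl⟩, hlt⟩ := Metric.mem_closure_iff.1 hmem ε hε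
  refine ⟨d, hd, ?_⟩
  rw [IsFundamentalSymmetry.jNorm_eq he, map_sub, ← dist_eq_norm]
  exact hlt

end KreinSpaces

/-! ### Invertible Gram operators and the Kreĭn spaces they define -/

section GramOperator

variable {E : Type*} [NormedAddCommGroup E] [InnerProductSpace ℂ E] [CompleteSpace E]

/-- The sign of an invertible self-adjoint operator, and the square root of its modulus. -/
theorem IsSelfAdjoint.exists_sign_sqrt {G : E →L[ℂ] E} (hG : IsSelfAdjoint G) (hu : IsUnit G) :
    ∃ S Q R : E →L[ℂ] E, IsSelfAdjoint S ∧ IsSelfAdjoint Q ∧ Q * R = 1 ∧ R * Q = 1 ∧ S * S = 1 ∧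
      Commute S G ∧ Q * Q = S * G := by
  -- Invertibility keeps the spectrum away from `0`, where the sign function would be discontinuous.
  have h0 : ∀ x ∈ spectrum ℝ G, x ≠ 0 := by
    rintro x hx rfl
    exact spectrum.zero_notMem ℝ hu hx
  have hs : ∀ x ∈ spectrum ℝ G, √|x| ≠ 0 := fun x hx =>
    (Real.sqrt_pos.2 (abs_pos.2 (h0 x hx))).ne'
  have c1 : ContinuousOn (fun x : ℝ => |x|⁻¹ * x) (spectrum ℝ G) :=
    (continuousOn_id.abs.inv₀ fun x hx => abs_ne_zero.2 (h0 x hx)).mul continuousOn_id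
  have c2 : ContinuousOn (fun x : ℝ => √|x|) (spectrum ℝ G) := by fun_prop
  have c3 : ContinuousOn (fun x : ℝ => (√|x|)⁻¹) (spectrum ℝ G) := c2.inv₀ hs
  have m1 : cfc (fun x : ℝ => √|x|) G * cfc (fun x : ℝ => (√|x|)⁻¹) G = 1 := by
    rw [← cfc_mul _ _ G c2 c3, ← cfc_one ℝ G]
    exact cfc_congr fun x hx => mul_inv_cancel₀ (hs x hx)
  have m2 : cfc (fun x : ℝ => (√|x|)⁻¹) G * cfc (fun x : ℝ => √|x|) G = 1 := by
    rw [← cfc_mul _ _ G c3 c2, ← cfc_one ℝ G]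
    exact cfc_congr fun x hx => inv_mul_cancel₀ (hs x hx)
  refine ⟨cfc (fun x : ℝ => |x|⁻¹ * x) G, cfc (fun x : ℝ => √|x|) G,
    cfc (fun x : ℝ => (√|x|)⁻¹) G, cfc_predicate _ _, cfc_predicate _ _, m1, m2, ?_, ?_, ?_⟩
  · rw [← cfc_mul _ _ G c1 c1, ← cfc_one ℝ G]
    refine cfc_congr fun x hx => ?_
    have := h0 x hx
    have h2 : |x| ≠ 0 := abs_ne_zero.2 this
    simp only [Pi.one_apply]
    field_simp
    exact (sq_abs x).symm
  · simpa only [cfc_id ℝ G hG] using cfc_commute_cfc (fun x : ℝ => |x|⁻¹ * x) id G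
  · have : cfc (fun x : ℝ => |x|⁻¹ * x) G * G = cfc (fun x : ℝ => |x|⁻¹ * x * id x) G := by
      rw [cfc_mul _ _ G c1 continuousOn_id, cfc_id ℝ G hG]
    rw [this, ← cfc_mul _ _ G c2 c2]
    refine cfc_congr fun x hx => ?_
    have h2 : |x| ≠ 0 := abs_ne_zero.2 (h0 x hx)
    simp only [id]
    rw [Real.mul_self_sqrt (abs_nonneg x), mul_assoc, eq_inv_mul_iff_mul_eq₀ h2, abs_mul_abs_self]

/-- The fundamental decomposition consists of the eigenspaces of `S = sgn G` for `1` and `-1`. On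
them `±B[x,x] = ‖Q x‖²` with `Q = |G|^(1/2)`, and `Q` is a homeomorphism, so completeness is
inherited from `E`. -/
theorem isKreinSpace_of_isUnit {K : Type*} [AddCommGroup K] [Module ℂ K]
    {B : K →ₗ⋆[ℂ] K →ₗ[ℂ] ℂ} (e : K ≃ₗ[ℂ] E) {G : E →L[ℂ] E} (hG : IsSelfAdjoint G)
    (hu : IsUnit G) (hB : ∀ x y, B x y = ⟪G (e x), e y⟫_ℂ) : IsKreinSpace B := by
  obtain ⟨S, Q, R, hS, hQ, hQR, hRQ, hSS, hSG, hQQ⟩ := hG.exists_sign_sqrt hu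
  have hSS' : ∀ x, S (S x) = x := fun x => congrArg (fun A : E →L[ℂ] E => A x) hSS
  have hSG' : ∀ x, S (G x) = G (S x) := fun x => congrArg (fun A : E →L[ℂ] E => A x) hSG.eq
  have hQQ' : ∀ x, Q (Q x) = S (G x) := fun x => congrArg (fun A : E →L[ℂ] E => A x) hQQ
  have hGs := (ContinuousLinearMap.isSelfAdjoint_iff_isSymmetric.1 hG)
  have hSs := (ContinuousLinearMap.isSelfAdjoint_iff_isSymmetric.1 hS)
  have hQs := (ContinuousLinearMap.isSelfAdjoint_iff_isSymmetric.1 hQ)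
  have hRQ' : ∀ x, R (Q x) = x := fun x => congrArg (fun A : E →L[ℂ] E => A x) hRQ
  /- Both summands are eigenspaces of `S`, on which `±B` is the square of the norm of `Q`. -/
  have key : ∀ (c : ℂ) (F : K →ₗ⋆[ℂ] K →ₗ[ℂ] ℂ) (L : Submodule ℂ K),
      (∀ x, x ∈ L ↔ S (e x) = c • e x) → (∀ x ∈ L, F x x = ⟪Q (e x), Q (e x)⟫_ℂ) →
      IsHilbertOn F L := by
    intro c F L hL hF
    have hnorm : ∀ x ∈ L, √(F x x).re = ‖Q (e x)‖ := fun x hx => by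
      rw [norm_eq_sqrt_re_inner (𝕜 := ℂ), hF x hx]; rfl
    refine ⟨fun x hx h0 => ?_, fun u hu hc => ?_⟩
    · have hne : Q (e x) ≠ 0 := fun h => h0 <| by
        have := hRQ' (e x)
        rw [h, map_zero] at this
        exact e.map_eq_zero_iff.1 this.symm
      rw [hF x hx]
      refine lt_of_lt_of_eq (pow_pos (norm_pos_iff.2 hne) 2) ?_
      exact (inner_self_eq_norm_sq (𝕜 := ℂ) _).symm
    · have hcau : CauchySeq fun n => Q (e (u n)) := Metric.cauchySeq_iff.2 fun ε hε => by
        obtain ⟨N, hN⟩ := hc ε hε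
        refine ⟨N, fun m hm n hn => ?_⟩
        have := hN m hm n hn
        rwa [hnorm _ (L.sub_mem (hu m) (hu n)), map_sub, map_sub, ← dist_eq_norm] at this
      obtain ⟨y, hy⟩ := cauchySeq_tendsto_of_complete hcau
      have hlim : Filter.Tendsto (fun n => e (u n)) Filter.atTop (nhds (R y)) := by
        simpa only [Function.comp_def, hRQ'] using (R.continuous.tendsto y).comp hy
      have hyR : Q (R y) = y := congrArg (fun A : E →L[ℂ] E => A y) hQR
      have hmem : e.symm (R y) ∈ L := by
        rw [hL, e.apply_symm_apply]
        refine tendsto_nhds_unique ((S.continuous.tendsto _).comp hlim) ?_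
        refine (hlim.const_smul c).congr fun n => ((hL _).1 (hu n)).symm
      refine ⟨_, hmem, fun ε hε => ?_⟩
      obtain ⟨N, hN⟩ := Metric.tendsto_atTop.1 hy ε hε
      refine ⟨N, fun n hn => ?_⟩
      rw [hnorm _ (L.sub_mem (hu n) hmem), map_sub, map_sub, e.apply_symm_apply, hyR,
        ← dist_eq_norm]
      exact hN n hn
  let P : Submodule ℂ K := (LinearMap.ker ((S : E →ₗ[ℂ] E) - LinearMap.id)).comap (e : K →ₗ[ℂ] E)
  let M : Submodule ℂ K := (LinearMap.ker ((S : E →ₗ[ℂ] E) + LinearMap.id)).comap (e : K →ₗ[ℂ] E)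
  have memP : ∀ x, x ∈ P ↔ S (e x) = e x := fun x => by simp [P, sub_eq_zero]
  have memM : ∀ x, x ∈ M ↔ S (e x) = -e x := fun x => by simp [M, eq_neg_iff_add_eq_zero]
  refine ⟨⟨fun x y => ?_⟩, P, M, ⟨?_, ?_⟩, ?_, ?_, ?_⟩
  · rw [hB, hB, inner_conj_symm]
    exact (hGs _ _).symm
  · rw [Submodule.disjoint_def]
    intro x hx hx'
    have h1 := (memP x).1 hx
    rw [(memM x).1 hx'] at h1
    have h2 : (2 : ℂ) • e x = 0 := by
      rw [two_smul]; nth_rewrite 1 [← h1]; exact neg_add_cancel _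
    exact e.map_eq_zero_iff.1 ((smul_eq_zero.1 h2).resolve_left two_ne_zero)
  · rw [codisjoint_iff, eq_top_iff]
    intro x _
    refine Submodule.mem_sup.2 ⟨(2⁻¹ : ℂ) • (x + e.symm (S (e x))), ?_,
      (2⁻¹ : ℂ) • (x - e.symm (S (e x))), ?_, ?_⟩
    · rw [memP]; simp [hSS', add_comm]
    · rw [memM]; simp [hSS', ← smul_neg]
    · rw [← smul_add, add_add_sub_cancel, ← two_smul ℂ x, smul_smul]; simp
  · intro x hx y hy
    -- `S` is symmetric and commutes with `G`; moving it from `x`, where it is `1`, to `y`, where it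
    -- is `-1`, changes the sign.
    have h1 : ⟪G (e x), e y⟫_ℂ = -⟪G (e x), e y⟫_ℂ := by
      conv_lhs => rw [← (memP x).1 hx, ← hSG']
      rw [← inner_neg_right, ← (memM y).1 hy]
      exact hSs _ _
    rw [hB]
    exact self_eq_neg.1 h1
  · refine key 1 B P (fun x => by rw [memP, one_smul]) fun x hx => ?_
    rw [hB]
    refine Eq.trans ?_ (hQs _ _)
    rw [ContinuousLinearMap.coe_coe, hQQ', hSG', (memP x).1 hx]
  · refine key (-1) (-B) M (fun x => by rw [memM, neg_smul, one_smul]) fun x hx => ?_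
    rw [LinearMap.neg_apply, LinearMap.neg_apply, hB]
    refine Eq.trans ?_ (hQs _ _)
    rw [ContinuousLinearMap.coe_coe, hQQ', hSG', (memM x).1 hx, map_neg, inner_neg_left]

end GramOperator

/-! ### Inner products represented by an operator -/

section Representation

variable {H : Type*} [NormedAddCommGroup H] [InnerProductSpace ℂ H]

/-- The inner product `B` on `K` is represented by `T`: `B[u, v] = (T u, v)` for `u ∈ dom T` and
`v ∈ K`. -/
def Represents {K : Submodule ℂ H} (B : K →ₗ⋆[ℂ] K →ₗ[ℂ] ℂ) (T : H →ₗ.[ℂ] H) : Prop :=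
  ∃ h : T.domain ≤ K, ∀ (u : T.domain) (v : K), B ⟨u, h u.2⟩ v = ⟪T u, (v : H)⟫_ℂ

variable {K : Submodule ℂ H} {B : K →ₗ⋆[ℂ] K →ₗ[ℂ] ℂ} {T : H →ₗ.[ℂ] H} {J : K →ₗ[ℂ] K}

namespace Represents

theorem exists_inverse (hB : Represents B T) (hT : Function.Bijective T) :
    ∃ R : H →ₗ[ℂ] K, (∀ y v, B (R y) v = ⟪y, (v : H)⟫_ℂ) ∧
      (∀ y, ∃ h : (R y : H) ∈ T.domain, T ⟨R y, h⟩ = y) ∧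
      ∀ (x : K) (h : (x : H) ∈ T.domain), R (T ⟨x, h⟩) = x := by
  obtain ⟨h, hB⟩ := hB
  let e := LinearEquiv.ofBijective T.toFun hT
  have he : ∀ y, T (e.symm y) = y := e.apply_symm_apply
  refine ⟨Submodule.inclusion h ∘ₗ (e.symm : H →ₗ[ℂ] T.domain), fun y v => ?_, fun y => ?_,
    fun x hx => ?_⟩
  · exact (hB (e.symm y) v).trans (by rw [he])
  · exact ⟨(e.symm y).2, he y⟩
  · exact congrArg (Submodule.inclusion h) (e.symm_apply_apply ⟨(x : H), hx⟩)

theorem exists_apply_eq (hB : Represents B T) (hT : Function.Bijective T) (y : H) :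
    ∃ d : K, (d : H) ∈ T.domain ∧ ∀ v, B d v = ⟪y, (v : H)⟫_ℂ := by
  obtain ⟨R, hR, hR', -⟩ := hB.exists_inverse hT
  exact ⟨R y, (hR' y).1, hR y⟩

/-- A vector `x` orthogonal to `dom T` is in particular orthogonal to `T⁻¹x`, and `[T⁻¹x,x] = ‖x‖²`.
-/
theorem kreinDense (hB : Represents B T) (hT : Function.Bijective T) (hK : IsKreinSpace B) :
    KreinDense B {x : K | (x : H) ∈ T.domain} := by
  refine hK.kreinDense (T.domain.comap K.subtype) fun x hx => ?_
  obtain ⟨d, hd, hdv⟩ := hB.exists_apply_eq hT (x : H)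
  have := hx d hd
  rw [hdv, inner_self_eq_zero] at this
  exact Subtype.ext this

/-- In the Hilbert space defined by a fundamental symmetry, `J T⁻¹` is symmetric and everywhere
defined, hence bounded. -/
theorem exists_continuous_inverse {E : Type*} [NormedAddCommGroup E] [InnerProductSpace ℂ E]
    [CompleteSpace E] {e : K ≃ₗ[ℂ] E} (hJ : IsFundamentalSymmetry B J)
    (he : ∀ x y, ⟪e x, e y⟫_ℂ = B (J x) y) {R : H →ₗ[ℂ] K}
    (hR : ∀ y v, B (R y) v = ⟪y, (v : H)⟫_ℂ) :
    ∃ S : E →L[ℂ] E, ∀ x : K, S (e x) = e (J (R x)) := by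
  let S : E →ₗ[ℂ] E := e ∘ₗ J ∘ₗ R ∘ₗ K.subtype ∘ₗ (e.symm : E →ₗ[ℂ] K)
  have hS : ∀ x : K, S (e x) = e (J (R x)) := fun x => by simp [S]
  have hS' : ∀ x y : K, ⟪S (e x), e y⟫_ℂ = ⟪(x : H), (y : H)⟫_ℂ := fun x y => by
    rw [hS, he, hJ.apply_apply, hR]
  have hsym : S.IsSymmetric := fun a b => by
    obtain ⟨x, rfl⟩ := e.surjective a
    obtain ⟨y, rfl⟩ := e.surjective b
    rw [hS', ← inner_conj_symm (e x), hS', inner_conj_symm]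
  -- Hellinger–Toeplitz theorem.
  exact ⟨⟨S, hsym.continuous⟩, hS⟩

/-- With `S = JT⁻¹` bounded, `‖x‖² = {Sx,x} ≤ ‖S‖{x,x}`. -/
theorem continuouslyEmbedded (hB : Represents B T) (hT : Function.Bijective T)
    (hK : IsKreinSpace B) : ContinuouslyEmbedded B := by
  intro J hJ
  obtain ⟨E, _, _, _, e, he⟩ := hJ.exists_hilbertSpace hK.1
  obtain ⟨R, hR, -, -⟩ := hB.exists_inverse hT
  obtain ⟨S, hS⟩ := exists_continuous_inverse hJ he hR
  refine ⟨√‖S‖, fun x => ?_⟩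
  have h1 : ⟪S (e x), e x⟫_ℂ = ⟪(x : H), (x : H)⟫_ℂ := by
    rw [hS, he, hJ.apply_apply, hR]
  have h2 : ‖(x : H)‖ ^ 2 ≤ ‖S‖ * ‖e x‖ ^ 2 := by
    calc ‖(x : H)‖ ^ 2 = ‖⟪S (e x), e x⟫_ℂ‖ := by
          rw [h1, inner_self_eq_norm_sq_to_K]; simp
      _ ≤ ‖S (e x)‖ * ‖e x‖ := norm_inner_le_norm _ _
      _ ≤ ‖S‖ * ‖e x‖ * ‖e x‖ := by gcongr; exact S.le_opNorm _
      _ = _ := by ring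
  rw [IsFundamentalSymmetry.jNorm_eq he]
  refine (Real.le_sqrt_of_sq_le h2).trans_eq ?_
  rw [Real.sqrt_mul (norm_nonneg _), Real.sqrt_sq (norm_nonneg _)]

/-- All properties follow from `[f,v] = (Af,v)`: non-negativity is `[Af,f] = ‖Af‖²`, and
self-adjointness combines the resulting symmetry with surjectivity of `A`. -/
theorem memClassN (hB : Represents B T) (hT : Function.Bijective T) (hK : IsKreinSpace B) :
    MemClassN B (rangeRestriction T K) := by
  obtain ⟨R, hR, hR', hRT⟩ := hB.exists_inverse hT
  obtain ⟨hdom, hB⟩ := hB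
  set A := rangeRestriction T K with hA
  have hBA : ∀ (f : A.domain) (v : K), B f v = ⟪(A f : H), (v : H)⟫_ℂ := fun f v =>
    hB ⟨f, f.2.1⟩ v
  have hBA' : ∀ (f : A.domain) (v : K), B v f = ⟪(v : H), (A f : H)⟫_ℂ := fun f v => by
    rw [← hK.1.eq, hBA, inner_conj_symm]
  have hsurj : ∀ y : K, ∃ f : A.domain, A f = y ∧ (f : K) = R y := fun y => by
    obtain ⟨h, hy⟩ := hR' y
    exact ⟨⟨R y, h, by rw [hy]; exact y.2⟩, Subtype.ext hy, rfl⟩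
  have hRA : ∀ f : A.domain, R (A f) = f := fun f => hRT f f.2.1
  have hdense : KreinDense B (A.domain : Set K) := hK.kreinDense _ fun x hx => by
    obtain ⟨f, hf, -⟩ := hsurj x
    have := hx f f.2
    rw [hBA, hf, inner_self_eq_zero] at this
    exact Subtype.ext this
  refine ⟨hK, ⟨hdense, fun J hJ f => ?_⟩, ⟨hdense, fun J hJ g k => ⟨?_, fun h => ?_⟩⟩,
    ⟨fun f g hfg => ?_, fun y => ?_⟩, fun J hJ => ?_⟩
  · rw [jInner, hJ.apply_apply, hBA', inner_self_eq_norm_sq_to_K]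
    norm_cast
    exact ⟨sq_nonneg _, Complex.ofReal_im _⟩
  · rintro ⟨h, rfl⟩ f
    rw [jInner, jInner, hJ.apply_apply, hJ.symmetric hK.1, hJ.apply_apply, hBA' ⟨g, h⟩, hBA]
  -- The solution `g₀` of `A g₀ = J k` satisfies `[Af,g₀] = (Af,Jk) = {f,k} = [Af,g]`; since `A` is
  -- onto and the inner product is nondegenerate, `g = g₀`.
  · obtain ⟨g₀, hg₀, -⟩ := hsurj (J k)
    have hg : g = g₀ := sub_eq_zero.1 <| hK.eq_zero_of_forall_left fun y => by
      obtain ⟨f, rfl, -⟩ := hsurj y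
      have := h f
      rw [jInner, jInner, hJ.apply_apply, hJ.symmetric hK.1, hBA f] at this
      rw [map_sub, this, hBA' g₀, hg₀, sub_self]
    subst hg
    exact ⟨g₀.2, by rw [Subtype.coe_eta, hg₀, hJ.apply_apply]⟩
  · exact Subtype.ext (by rw [← hRA f, ← hRA g, hfg])
  · obtain ⟨f, hf, -⟩ := hsurj y
    exact ⟨f, hf⟩
  · obtain ⟨E, _, _, _, e, he⟩ := hJ.exists_hilbertSpace hK.1
    obtain ⟨S, hS⟩ := exists_continuous_inverse hJ he hR
    refine ⟨‖S‖, fun f => ?_⟩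
    -- `J` is isometric, so a bound for `JA⁻¹` is one for `A⁻¹`.
    have hnorm : ‖e f‖ = ‖e (J f)‖ := by
      rw [norm_eq_sqrt_re_inner (𝕜 := ℂ), norm_eq_sqrt_re_inner (𝕜 := ℂ) (e (J f)), he, he,
        hJ.symmetric hK.1 (J f), hJ.apply_apply]
    rw [IsFundamentalSymmetry.jNorm_eq he, IsFundamentalSymmetry.jNorm_eq he, hnorm]
    conv_lhs => rw [← hRA f, ← hS]
    exact S.le_opNorm _

end Represents

end Representation

/-! ### Closures, representing operators and the gap point `0` -/

namespace SymmForm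

variable {H : Type*} [NormedAddCommGroup H] [InnerProductSpace ℂ H]

theorem shift_apply (t : SymmForm H) (lam : ℝ) (u v : t.domain) :
    t.shift lam u v = t.form u v - lam * ⟪(u : H), (v : H)⟫_ℂ := rfl

theorem shift_zero (t : SymmForm H) : t.shift 0 = t.form := by
  refine LinearMap.ext fun u => LinearMap.ext fun v => ?_
  rw [shift_apply, Complex.ofReal_zero, zero_mul, sub_zero]

variable [CompleteSpace H] {t : SymmForm H} {T : H →ₗ.[ℂ] H}

/-- For fixed `u ∈ dom T`, both `t[u,·]` and `(Tu,·)` are continuous on the Kreĭn space with inner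
product `t_λ`, the second by the continuous embedding; they agree on the dense subspace `dom T`. -/
theorem IsClosureOf.represents {hT : IsSelfAdjoint T} (h : t.IsClosureOf (operatorForm T hT)) :
    Represents t.form T := by
  obtain ⟨-, ⟨hdom, hext⟩, lam, ⟨hK, hemb⟩, hdense⟩ := h
  refine ⟨hdom, fun u v => ?_⟩
  obtain ⟨J, hJ⟩ := hK.exists_fundamentalSymmetry
  obtain ⟨E, _, _, _, e, he⟩ := hJ.exists_hilbertSpace hK.1
  obtain ⟨C, hC⟩ := hemb J hJ
  have hJn := IsFundamentalSymmetry.jNorm_eq he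
  set u' : t.domain := ⟨u, hdom u.2⟩ with hu'
  have hform : ∀ w : t.domain, t.form u' w - ⟪T u, (w : H)⟫_ℂ =
      ⟪e (J u'), e w⟫_ℂ + ⟪(lam : ℂ) • (u : H) - T u, (w : H)⟫_ℂ := fun w => by
    rw [he, hJ.apply_apply, shift_apply, inner_sub_left, inner_smul_left, Complex.conj_ofReal]
    ring
  have hbound : ∀ w : t.domain, ‖t.form u' w - ⟪T u, (w : H)⟫_ℂ‖ ≤
      (‖e (J u')‖ + ‖(lam : ℂ) • (u : H) - T u‖ * C) * jNorm (t.shift lam) J w := fun w => by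
    rw [hform, add_mul, mul_assoc]
    refine (norm_add_le _ _).trans (add_le_add ?_ ?_)
    · rw [hJn]; exact norm_inner_le_norm _ _
    · refine (norm_inner_le_norm _ _).trans ?_
      gcongr
      exact hC w
  set c := ‖e (J u')‖ + ‖(lam : ℂ) • (u : H) - T u‖ * C
  rw [← sub_eq_zero, ← norm_le_zero_iff]
  refine le_of_forall_pos_le_add fun ε hε => ?_
  -- Dividing by `|c| + 1` covers `c ≤ 0`, which is possible because `C` has no prescribed sign.
  obtain ⟨d, hd, hdv⟩ := hdense J hJ v (ε / (|c| + 1)) (by positivity)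
  have hd0 : t.form u' d - ⟪T u, (d : H)⟫_ℂ = 0 := sub_eq_zero.2 (hext u ⟨d, hd⟩)
  have hsub : t.form u' v - ⟪T u, (v : H)⟫_ℂ =
      t.form u' (v - d) - ⟪T u, ((v - d : t.domain) : H)⟫_ℂ := by
    rw [map_sub, Submodule.coe_sub, inner_sub_right]
    linear_combination hd0
  rw [hsub, zero_add]
  calc _ ≤ c * jNorm (t.shift lam) J (v - d) := hbound _
    _ ≤ (|c| + 1) * (ε / (|c| + 1)) := by
        have : c ≤ |c| + 1 := (le_abs_self c).trans (by linarith)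
        gcongr
        exact Real.sqrt_nonneg _
    _ = ε := by field_simp

/-- In the Hilbert space of `t_λ`, the form `t` has Gram operator `G = J + λ ι*ι`, where `ι` is the
embedding into `H`. Solving `t[x,·] = {w,·}` amounts to inverting `T`, so `G` is bijective even
though `0` was not the given gap point. -/
theorem IsClosedForm.isGapPoint_zero (h : t.IsClosedForm) (hB : Represents t.form T)
    (hT : Function.Bijective T) : t.IsGapPoint 0 := by
  obtain ⟨lam, hK, hemb⟩ := h
  obtain ⟨J, hJ⟩ := hK.exists_fundamentalSymmetry
  obtain ⟨E, _, _, _, e, he⟩ := hJ.exists_hilbertSpace hK.1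
  obtain ⟨C, hC⟩ := hemb J hJ
  have hJn := IsFundamentalSymmetry.jNorm_eq he
  obtain ⟨R, hR, -, -⟩ := hB.exists_inverse hT
  let emb : E →L[ℂ] H := (t.domain.subtype ∘ₗ (e.symm : E →ₗ[ℂ] t.domain)).mkContinuous C fun a => by
    obtain ⟨x, rfl⟩ := e.surjective a
    have := hC x
    rw [hJn] at this
    simpa using this
  have hemb' : ∀ x, emb (e x) = x := fun x => by simp [emb]
  let JE : E →ₗ[ℂ] E := e ∘ₗ J ∘ₗ (e.symm : E →ₗ[ℂ] t.domain)
  have hJE : ∀ x, JE (e x) = e (J x) := fun x => by simp [JE]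
  have hJs : JE.IsSymmetric := fun a b => by
    obtain ⟨x, rfl⟩ := e.surjective a
    obtain ⟨y, rfl⟩ := e.surjective b
    rw [hJE, hJE, he, he, hJ.symmetric hK.1 (J x)]
  /- The Gram operator of `t` in the Hilbert space `E`. -/
  let G : E →L[ℂ] E := ⟨JE, hJs.continuous⟩ + (lam : ℂ) • (emb.adjoint ∘L emb)
  have hG : ∀ x y, ⟪G (e x), e y⟫_ℂ = t.form x y := fun x y => by
    have : G (e x) = JE (e x) + (lam : ℂ) • emb.adjoint (emb (e x)) := rfl
    rw [this, inner_add_left, inner_smul_left, ContinuousLinearMap.adjoint_inner_left, hemb',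
      hemb', hJE, he, hJ.apply_apply, shift_apply, Complex.conj_ofReal]
    ring
  have hGs : IsSelfAdjoint G := ContinuousLinearMap.isSelfAdjoint_iff_isSymmetric.2 fun a b => by
    obtain ⟨x, rfl⟩ := e.surjective a
    obtain ⟨y, rfl⟩ := e.surjective b
    rw [ContinuousLinearMap.coe_coe, ← inner_conj_symm (e x), hG, hG, t.symm.eq]
  -- If `t[x,·] = 0`, then `‖x‖² = t[T⁻¹x,x] = 0`.
  have hinj : Function.Injective G := (injective_iff_map_eq_zero G).2 fun a ha => by
    obtain ⟨x, rfl⟩ := e.surjective a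
    have h0 : (x : H) = 0 := by
      rw [← inner_self_eq_zero (𝕜 := ℂ), ← hR, ← t.symm.eq, ← hG, ha, inner_zero_left, map_zero]
    rw [Subtype.ext h0 (a2 := (0 : t.domain)), map_zero]
  have hsurj : Function.Surjective G := fun b => by
    obtain ⟨w, rfl⟩ := e.surjective b
    -- The preimage comes from `{w,·} = t_λ[Jw,·] = t[Jw,·] - λ(Jw,·)` and `(Jw,·) = t[T⁻¹Jw,·]`.
    refine ⟨e (J w - (lam : ℂ) • R (J w : t.domain)), ext_inner_right ℂ fun b => ?_⟩
    obtain ⟨y, rfl⟩ := e.surjective b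
    rw [hG, he, map_sub, map_smulₛₗ, LinearMap.sub_apply, LinearMap.smul_apply, hR, shift_apply,
      Complex.conj_ofReal, smul_eq_mul]
  have hK0 : IsKreinSpace t.form := isKreinSpace_of_isUnit e hGs
    (ContinuousLinearMap.isUnit_iff_bijective.2 ⟨hinj, hsurj⟩) fun x y => (hG x y).symm
  rw [IsGapPoint, shift_zero]
  exact ⟨hK0, hB.continuouslyEmbedded hT hK0⟩

theorem IsGapPoint.isClosureOf_operatorForm {hT : IsSelfAdjoint T} (h : t.IsGapPoint 0)
    (hB : Represents t.form T) (hTinv : Function.Bijective T) :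
    t.IsClosureOf (operatorForm T hT) := by
  have hK := h.1
  refine ⟨⟨0, h⟩, ⟨hB.1, fun u v => hB.2 u ⟨v, hB.1 v.2⟩⟩, 0, h, ?_⟩
  rw [shift_zero] at hK ⊢
  exact hB.kreinDense hTinv hK

theorem isClosureOf_operatorForm_iff (hT : IsSelfAdjoint T) (hTinv : Function.Bijective T) :
    t.IsClosureOf (operatorForm T hT) ↔ t.IsGapPoint 0 ∧ t.IsRepresentingOperator T :=
  ⟨fun h => ⟨h.1.isGapPoint_zero h.represents hTinv, hT, h.represents⟩,
    fun h => h.1.isClosureOf_operatorForm h.2.2 hTinv⟩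

end SymmForm

/-! ### The correspondence between forms and triples -/

section Correspondence

variable {H : Type*} [NormedAddCommGroup H] [InnerProductSpace ℂ H] [CompleteSpace H]
  {T : H →ₗ.[ℂ] H} {hT : IsSelfAdjoint T}

/-- A triple in `𝒩_T` determines a form in `ℳ_T`. -/
theorem exists_closure_of_mem_completionTriplesOf {q : SpaceTriple H}
    (hq : q ∈ completionTriplesOf T hT) :
    ∃ t ∈ closuresOf T hT, t.domain = q.space ∧ HEq t.form q.form := by
  obtain ⟨⟨hK, hext, hdense⟩, hemb, -⟩ := hq
  let t : SymmForm H := ⟨q.space, q.form, hT.dense_domain.mono hext.1, hK.1⟩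
  have hgap : t.IsGapPoint 0 := by
    rw [SymmForm.IsGapPoint, t.shift_zero]
    exact ⟨hK, hemb⟩
  refine ⟨t, ⟨⟨0, hgap⟩, hext, 0, hgap, ?_⟩, rfl, HEq.rfl⟩
  rw [t.shift_zero]
  exact hdense

theorem formToTriple_mem_completionTriplesOf (hTinv : Function.Bijective T) {t : SymmForm H}
    (ht : t ∈ closuresOf T hT) : formToTriple t ∈ completionTriplesOf T hT := by
  obtain ⟨⟨hK, hemb⟩, hrep⟩ := (SymmForm.isClosureOf_operatorForm_iff hT hTinv).1 ht
  rw [t.shift_zero] at hK hemb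
  exact ⟨⟨hK, ht.2.1, Represents.kreinDense hrep.2 hTinv hK⟩, hemb,
    congrArg (rangeRestriction · t.domain) hrep.eq⟩

theorem formToTriple_injective : Function.Injective (formToTriple (H := H)) := by
  intro t t' h
  have h1 : t.domain = t'.domain := congrArg SpaceTriple.space h
  have h2 : HEq (formToTriple t).form (formToTriple t').form := by rw [h]
  exact SymmForm.ext h1 h2

theorem exists_formToTriple_eq (hTinv : Function.Bijective T) {q : SpaceTriple H}
    (hq : q ∈ completionTriplesOf T hT) : ∃ t ∈ closuresOf T hT, formToTriple t = q := by
  obtain ⟨t, ht, h1, h2⟩ := exists_closure_of_mem_completionTriplesOf hq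
  refine ⟨t, ht, ?_⟩
  have h3 := (formToTriple_mem_completionTriplesOf hTinv ht).2.2
  have h4 := hq.2.2
  obtain ⟨K, B, A⟩ := q
  obtain ⟨D, F, _, _⟩ := t
  -- Once the spaces are identified, the heterogeneous equality of the inner products becomes an
  -- ordinary one.
  obtain rfl : D = K := h1
  obtain rfl : F = B := eq_of_heq h2
  exact congrArg (SpaceTriple.mk D F) (h3.trans h4.symm)

end Correspondence

theorem mainTheorem5 {H : Type*} [NormedAddCommGroup H] [InnerProductSpace ℂ H] [CompleteSpace H]
    (T : H →ₗ.[ℂ] H) (hT : IsSelfAdjoint T) (hTinv : IsBoundedlyInvertible T) :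
    Set.BijOn formToTriple (closuresOf T hT) (completionTriplesOf T hT) ∧
    (∀ q ∈ completionTriplesOf T hT, MemClassN q.form q.op) ∧
    closuresOf T hT = {t | t.IsGapPoint 0 ∧ t.IsRepresentingOperator T} ∧
    closuresOf T hT = {t | t.IsClosedForm ∧ t.IsRepresentingOperator T} := by
  have hbij := hTinv.1
  refine ⟨⟨fun t ht => formToTriple_mem_completionTriplesOf hbij ht,
    formToTriple_injective.injOn, fun q hq => exists_formToTriple_eq hbij hq⟩, fun q hq => ?_,
    ?_, ?_⟩
  · obtain ⟨t, ht, rfl⟩ := exists_formToTriple_eq hbij hq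
    obtain ⟨⟨hK, -⟩, hrep⟩ := (SymmForm.isClosureOf_operatorForm_iff hT hbij).1 ht
    rw [t.shift_zero] at hK
    rw [hq.2.2]
    exact Represents.memClassN hrep.2 hbij hK
  · exact Set.ext fun t => SymmForm.isClosureOf_operatorForm_iff hT hbij
  · refine Set.ext fun t => (SymmForm.isClosureOf_operatorForm_iff hT hbij).trans ?_
    exact ⟨fun h => ⟨⟨0, h.1⟩, h.2⟩, fun h => ⟨h.1.isGapPoint_zero h.2.2 hbij, h.2⟩⟩
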